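/- Let $p$ be a prime, let $K$ be a perfect field of characteristic $p$ equipped with a negative pseudovaluation $\mu$ (for instance the trivial valuation $\mu(x)=0$ for $x\neq 0$, $\mu(0)=\infty$), and let $A$ be a finitely generated commutative $K$-algebra equipped with an admissible pseudovaluation $\nu$. Here a *pseudovaluation* on a commutative ring $B$ is a function $\nu:B\to\mathbb R\cup\{\pm\infty\}$ with $\nu(0)=\infty$, $\nu(1)=0$, $\nu(a\pm b)\ge\min\{\nu(a),\nu(b)\}$, and $\nu(ab)\ge\nu(a)+\nu(b)$ whenever $\nu(a),\nu(b)\ne-\infty$; it is *negative* if it never takes the value $-\infty$ and $\nu(a)\le 0$ for all $a\neq0$. A negative pseudovaluation $\nu$ on $A$ is *admissible* if for some surjection of $K$-algebras $\varphi:K[T_1,\dots,T_m]\to A$ and some reals $d_1,\dots,d_m>0$ it is linearly equivalent to the function $$\bar\nu(b)=\sup\{\nu_d(g)\mid \varphi(g)=b\},\qquad \nu_d\Big(\sum_k c_kT^k\Big)=\inf_k\{\mu(c_k)-k_1d_1-\dots-k_md_m\};$$ two functions $\nu_1,\nu_2$ are *linearly equivalent* if there are reals $c_1,c_2>0$ and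 $e_1,e_2\ge0$ with $\nu_1\ge c_2\nu_2-e_2$ and $\nu_2\ge c_1\nu_1-e_1$. Let $W(A)$ be the ring of $p$-typical Witt vectors, $V$ its Verschiebung, and let $W^\dagger(A)\subset W(A)$ be the subring of overconvergent Witt vectors, i.e. of those $(a_0,a_1,\dots)$ for which there are reals $\varepsilon>0$ and $c$ with $i+\varepsilon p^{-i}\nu(a_i)\ge c$ for all $i\ge0$. Let $\mathbf w_0:W^\dagger(A)\to A$ be the homomorphism $(a_0,a_1,\dots)\mapsto a_0$. Let $f\in W^\dagger(A)[T]$ be a polynomial, and let $a\in A$ be an element such that, applying $\mathbf w_0$ to the coefficients of $f$ and $f'$, one has $f(a)=0$ and $f'(a)$ is a unit in $A$. Then there is a unique $\alpha\in W^\dagger(A)$ such that $f(\alpha)=0$ and $\alpha\equiv a \bmod VW^\dagger(A)$, i.e. $\alpha-[a]\in VW^\dagger(A)$, where $[a]=(a,0,0,\dots)$. -/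

import Mathlib

open scoped WittVector

namespace OverconvergentWitt

/-! ### Order functions and pseudovaluations -/

/-- An order function on an abelian group, with values in `ℝ ∪ {∞} ∪ {-∞}`. -/
structure IsOrderFunction {A : Type*} [AddCommGroup A] (ν : A → EReal) : Prop where
  map_zero : ν 0 = ⊤
  min_le_add : ∀ a b, min (ν a) (ν b) ≤ ν (a + b)
  min_le_sub : ∀ a b, min (ν a) (ν b) ≤ ν (a - b)

/-- A pseudovaluation on a ring. -/
structure IsPseudovaluation {A : Type*} [CommRing A] (ν : A → EReal) : Prop
    extends IsOrderFunction ν where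
  map_one : ν 1 = 0
  add_le_mul : ∀ a b, ν a ≠ ⊥ → ν b ≠ ⊥ → ν a + ν b ≤ ν (a * b)

/-- A negative pseudovaluation: it is proper (it never takes the value `-∞`), and it is `≤ 0` on
all nonzero elements. -/
structure IsNegativePseudovaluation {A : Type*} [CommRing A] (ν : A → EReal) : Prop
    extends IsPseudovaluation ν where
  ne_bot : ∀ a, ν a ≠ ⊥
  nonpos : ∀ a, a ≠ 0 → ν a ≤ 0

/-- The quotient `b ↦ sup {ν a | φ a = b}` of a function `ν` along a map `φ`. -/
noncomputable def quotientFunction {A B : Type*} (φ : A → B) (ν : A → EReal) (b : B) : EReal :=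
  ⨆ (a : A) (_ : φ a = b), ν a

/-- The degree function `∑ cₖ Tᵏ ↦ inf {μ(cₖ) - k₁ d₁ - ⋯ - kₘ dₘ}` on `R[T₁, …, Tₘ]`. -/
noncomputable def degreeFunction {R : Type*} [CommRing R] (μ : R → EReal) {m : ℕ}
    (d : Fin m → ℝ) (f : MvPolynomial (Fin m) R) : EReal :=
  ⨅ k : Fin m →₀ ℕ, μ (f.coeff k) - ((∑ i, (k i : ℝ) * d i : ℝ) : EReal)

/-- Linear equivalence of functions. -/
def LinearlyEquivalent {A : Type*} (ν₁ ν₂ : A → EReal) : Prop :=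
  ∃ c₁ c₂ d₁ d₂ : ℝ, 0 < c₁ ∧ 0 < c₂ ∧ 0 ≤ d₁ ∧ 0 ≤ d₂ ∧
    ∀ a, (c₂ : EReal) * ν₂ a - (d₂ : EReal) ≤ ν₁ a ∧ (c₁ : EReal) * ν₁ a - (d₁ : EReal) ≤ ν₂ a

/-- `ν` is an admissible pseudovaluation on the `R`-algebra `B` (with respect to `μ` on `R`): it is
a negative pseudovaluation which is linearly equivalent to the quotient of a degree function along
a surjection `R[T₁, …, Tₘ] → B`. In particular, `B` is then finitely generated over `R`. -/
structure IsAdmissible {R B : Type*} [CommRing R] [CommRing B] [Algebra R B]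
    (μ : R → EReal) (ν : B → EReal) : Prop
    extends IsNegativePseudovaluation ν where
  exists_presentation : ∃ (m : ℕ) (φ : MvPolynomial (Fin m) R →ₐ[R] B) (d : Fin m → ℝ),
    Function.Surjective φ ∧ (∀ i, 0 < d i) ∧
      LinearlyEquivalent ν (quotientFunction φ (degreeFunction μ d))

/-! ### Overconvergent Witt vectors -/

/-- The Witt vector `α = (a₀, a₁, …)` has radius of convergence `ε`: the numbers
`i + ε p⁻ⁱ ν(aᵢ)` are bounded below by a real constant. -/
def HasRadius (p : ℕ) {A : Type*} (ν : A → EReal) (ε : ℝ) (α : WittVector p A) : Prop :=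
  ∃ c : ℝ, ∀ i : ℕ,
    (c : EReal) ≤ ((i : ℝ) : EReal) + ((ε / (p : ℝ) ^ i : ℝ) : EReal) * ν (α.coeff i)

/-- A Witt vector is overconvergent if it has some positive radius of convergence. -/
def IsOverconvergent (p : ℕ) {A : Type*} (ν : A → EReal) (α : WittVector p A) : Prop :=
  ∃ ε : ℝ, 0 < ε ∧ HasRadius p ν ε α

/-! ### The overconvergent Witt vectors form a subring -/

section Aux

variable {A : Type*} [CommRing A] {ν : A → EReal}

/-- The subgroup of elements of order at least `r`. -/
def filtration (hν : IsOrderFunction ν) (r : EReal) : AddSubgroup A where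
  carrier := {a | r ≤ ν a}
  zero_mem' := by simp [hν.map_zero]
  add_mem' {a b} ha hb := (le_min ha hb).trans (hν.min_le_add a b)
  neg_mem' {a} ha := by
    have := hν.min_le_sub 0 a
    rw [hν.map_zero, zero_sub] at this
    exact (le_min le_top ha).trans this

theorem mul_bound (hν : IsPseudovaluation ν) {a b : A} {r s : ℝ} (ha : (r : EReal) ≤ ν a)
    (hb : (s : EReal) ≤ ν b) : ((r + s : ℝ) : EReal) ≤ ν (a * b) := by
  rw [EReal.coe_add]
  refine (add_le_add ha hb).trans (hν.add_le_mul a b ?_ ?_)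
  · intro h; rw [h] at ha; simp at ha
  · intro h; rw [h] at hb; simp at hb

theorem pow_bound (hν : IsPseudovaluation ν) {a : A} {r : ℝ} (ha : (r : EReal) ≤ ν a) (n : ℕ) :
    ((n * r : ℝ) : EReal) ≤ ν (a ^ n) := by
  induction n with
  | zero => simp [hν.map_one]
  | succ n ih =>
    rw [pow_succ]
    have := mul_bound hν ih ha
    convert this using 2
    push_cast; ring

theorem prod_bound (hν : IsPseudovaluation ν) {σ : Type*} (s : Finset σ) (f : σ → A) (r : σ → ℝ)
    (h : ∀ i ∈ s, (r i : EReal) ≤ ν (f i)) :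
    ((∑ i ∈ s, r i : ℝ) : EReal) ≤ ν (∏ i ∈ s, f i) := by
  classical
  induction s using Finset.induction_on with
  | empty => simp [hν.map_one]
  | insert i s hi ih =>
    rw [Finset.sum_insert hi, Finset.prod_insert hi]
    exact mul_bound hν (h i (Finset.mem_insert_self i s))
      (ih fun j hj => h j (Finset.mem_insert_of_mem hj))

theorem aeval_bound (hν : IsPseudovaluation ν) {σ : Type*} {P : MvPolynomial σ ℤ} {w : σ → ℕ}
    {N : ℕ} (hP : P.IsWeightedHomogeneous w N) {x : σ → A} {t : ℝ}
    (h : ∀ s, w s ≤ N → ((w s * t : ℝ) : EReal) ≤ ν (x s)) :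
    ((N * t : ℝ) : EReal) ≤ ν (MvPolynomial.aeval x P) := by
  change _ ∈ filtration hν.toIsOrderFunction ((N * t : ℝ) : EReal)
  rw [MvPolynomial.aeval_def, MvPolynomial.eval₂_eq]
  refine AddSubgroup.sum_mem _ fun k hk => ?_
  have hw := hP (MvPolynomial.mem_support_iff.mp hk)
  rw [eq_intCast, ← zsmul_eq_mul]
  refine AddSubgroup.zsmul_mem _ ?_ _
  change ((N * t : ℝ) : EReal) ≤ ν _
  rw [Finsupp.weight_apply, Finsupp.sum] at hw
  have hle : ∀ i ∈ k.support, w i ≤ N := by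
    intro i hi
    have h1 : k i • w i ≤ ∑ j ∈ k.support, k j • w j :=
      Finset.single_le_sum (f := fun j => k j • w j) (fun _ _ => Nat.zero_le _) hi
    have h2 : 1 ≤ k i := Nat.one_le_iff_ne_zero.mpr (Finsupp.mem_support_iff.mp hi)
    rw [smul_eq_mul] at h1
    nlinarith
  have := prod_bound hν k.support (fun i => x i ^ k i) (fun i => k i * (w i * t))
    fun i hi => pow_bound hν (h i (hle i hi)) (k i)
  convert this using 2
  rw [← hw]
  push_cast
  rw [Finset.sum_mul]
  exact Finset.sum_congr rfl fun i _ => by simp; ring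

variable {p : ℕ} [hp : Fact p.Prime]

set_option linter.unusedSectionVars false

theorem wittPolynomial_homogeneous {ι : Type*} (b : ι) (n : ℕ) :
    (MvPolynomial.rename (fun i => (b, i)) (wittPolynomial p ℚ n)).IsWeightedHomogeneous
      (fun s : ι × ℕ => p ^ s.2) (p ^ n) := by
  rw [wittPolynomial_eq_sum_C_mul_X_pow, map_sum]
  refine MvPolynomial.IsWeightedHomogeneous.sum _ _ _ fun i hi => ?_
  simp only [map_mul, map_pow, MvPolynomial.rename_X, map_natCast]
  have h := (MvPolynomial.isWeightedHomogeneous_X ℚ (fun s : ι × ℕ => p ^ s.2) (b, i)).pow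
    (p ^ (n - i))
  have h2 := h.C_mul ((p : ℚ) ^ i)
  have hi' : i ≤ n := Nat.lt_succ_iff.mp (Finset.mem_range.mp hi)
  have e : p ^ (n - i) • p ^ i = p ^ n := by
    rw [smul_eq_mul, ← pow_add, Nat.sub_add_cancel hi']
  rw [e] at h2
  simpa using h2

theorem wittStructureInt_homogeneous {ι : Type*} (Φ : MvPolynomial ι ℤ) (d : ℕ)
    (hΦ : ∀ n, (MvPolynomial.bind₁ (fun b => MvPolynomial.rename (fun i => (b, i))
      (wittPolynomial p ℚ n)) (MvPolynomial.map (Int.castRingHom ℚ) Φ)).IsWeightedHomogeneous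
      (fun s : ι × ℕ => p ^ s.2) (d * p ^ n)) (n : ℕ) :
    (wittStructureInt p Φ n).IsWeightedHomogeneous (fun s : ι × ℕ => p ^ s.2) (d * p ^ n) := by
  have key : (wittStructureRat p (MvPolynomial.map (Int.castRingHom ℚ) Φ) n).IsWeightedHomogeneous
      (fun s : ι × ℕ => p ^ s.2) (d * p ^ n) := by
    induction n using Nat.strong_induction_on with
    | _ n ih =>
      rw [wittStructureRat_rec]
      refine ((hΦ n).sub (MvPolynomial.IsWeightedHomogeneous.sum _ _ _ fun i hi => ?_)).C_mul _
      have hi' : i < n := Finset.mem_range.mp hi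
      have h := ((ih i hi').pow (p ^ (n - i))).C_mul ((p : ℚ) ^ i)
      have e : p ^ (n - i) • (d * p ^ i) = d * p ^ n := by
        rw [smul_eq_mul, mul_left_comm, ← pow_add, Nat.sub_add_cancel hi'.le]
      rwa [e] at h
  rw [← map_wittStructureInt] at key
  intro k hk
  refine key (d := k) ?_
  rw [MvPolynomial.coeff_map]
  simpa using hk

/-- A coefficientwise form of overconvergence. -/
theorem isOverconvergent_iff (α : WittVector p A) :
    IsOverconvergent p ν α ↔ ∃ δ : ℝ, 0 < δ ∧ ∃ c : ℝ, ∀ i : ℕ,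
      (((p : ℝ) ^ i * (c - δ * i) : ℝ) : EReal) ≤ ν (α.coeff i) := by
  have hp0 : (0 : ℝ) < p := by exact_mod_cast hp.out.pos
  have key : ∀ (ε : ℝ), 0 < ε → ∀ (c : ℝ) (i : ℕ) (x : EReal),
      (c : EReal) ≤ ((i : ℝ) : EReal) + ((ε / (p : ℝ) ^ i : ℝ) : EReal) * x ↔
      (((p : ℝ) ^ i * (c / ε - 1 / ε * i) : ℝ) : EReal) ≤ x := by
    intro ε hε c i x
    have hq : (0 : ℝ) < (p : ℝ) ^ i := pow_pos hp0 i
    have hpos : (0 : ℝ) < ε / (p : ℝ) ^ i := div_pos hε hq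
    induction x using EReal.rec with
    | bot =>
      rw [EReal.coe_mul_bot_of_pos hpos, EReal.add_bot]
      simp only [le_bot_iff, EReal.coe_ne_bot]
    | top =>
      rw [EReal.coe_mul_top_of_pos hpos, EReal.coe_add_top]
      simp only [le_top]
    | coe x =>
      rw [← EReal.coe_mul, ← EReal.coe_add, EReal.coe_le_coe_iff, EReal.coe_le_coe_iff,
        div_mul_eq_mul_div, ← sub_le_iff_le_add', le_div_iff₀ hq]
      have : (p : ℝ) ^ i * (c / ε - 1 / ε * i) = ((c - i) * (p : ℝ) ^ i) / ε := by
        field_simp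
      rw [this, div_le_iff₀ hε, mul_comm ε x]
  constructor
  · rintro ⟨ε, hε, c, h⟩
    exact ⟨1 / ε, by positivity, c / ε, fun i => (key ε hε c i _).mp (h i)⟩
  · rintro ⟨δ, hδ, c, h⟩
    refine ⟨1 / δ, by positivity, c / δ, fun i => (key (1 / δ) (by positivity) _ i _).mpr ?_⟩
    have e : c / δ / (1 / δ) - 1 / (1 / δ) * i = c - δ * i := by field_simp
    rw [e]
    exact h i

theorem isOverconvergent_peval (hν : IsPseudovaluation ν) {k : ℕ}
    (φ : ℕ → MvPolynomial (Fin k × ℕ) ℤ) (d : ℕ) (hd : d ≤ p)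
    (hφ : ∀ n, (φ n).IsWeightedHomogeneous (fun s : Fin k × ℕ => p ^ s.2) (d * p ^ n))
    (x : Fin k → WittVector p A) (hx : ∀ b, IsOverconvergent p ν (x b)) (y : WittVector p A)
    (hy : ∀ n, y.coeff n = WittVector.peval (φ n) fun b => (x b).coeff) :
    IsOverconvergent p ν y := by
  have hp0 : (0 : ℝ) < p := by exact_mod_cast hp.out.pos
  simp only [isOverconvergent_iff] at hx ⊢
  choose δ hδ c hc using hx
  obtain ⟨D, hD⟩ : ∃ D : ℝ, 0 < D ∧ ∀ b, δ b ≤ D :=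
    ⟨1 + ∑ b, δ b, by have := Finset.sum_nonneg fun b (_ : b ∈ Finset.univ) => (hδ b).le; linarith,
      fun b => by
        have := Finset.single_le_sum (fun b _ => (hδ b).le) (Finset.mem_univ b)
        linarith⟩
  obtain ⟨C, hC⟩ : ∃ C : ℝ, ∀ b, C ≤ c b :=
    ⟨-∑ b, |c b|, fun b => by
      have := Finset.single_le_sum (fun b _ => abs_nonneg (c b)) (Finset.mem_univ b)
      have := neg_abs_le (c b)
      linarith⟩
  refine ⟨(d + 1) * D, by have := hD.1; positivity, d * (C - D), fun n => ?_⟩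
  rw [hy]
  have hb := aeval_bound hν (hφ n) (x := Function.uncurry fun b => (x b).coeff)
    (t := C - D * (n + 1)) ?_
  · refine le_trans (EReal.coe_le_coe_iff.mpr ?_) hb
    push_cast
    have h1 : (0 : ℝ) ≤ (p : ℝ) ^ n := (pow_pos hp0 n).le
    have h2 : (0 : ℝ) ≤ (p : ℝ) ^ n * (D * n) :=
      mul_nonneg h1 (mul_nonneg hD.1.le n.cast_nonneg)
    nlinarith
  · rintro ⟨b, i⟩ hs
    refine le_trans (EReal.coe_le_coe_iff.mpr ?_) (hc b i)
    have hi : i ≤ n + 1 := by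
      have h1 : p ^ i ≤ p ^ (n + 1) :=
        hs.trans (by rw [pow_succ, mul_comm]; exact Nat.mul_le_mul_left _ hd)
      exact (Nat.pow_le_pow_iff_right hp.out.one_lt).mp h1
    have hi' : (i : ℝ) ≤ n + 1 := by exact_mod_cast hi
    push_cast
    refine mul_le_mul_of_nonneg_left ?_ (pow_pos hp0 i).le
    have h1 : δ b * i ≤ D * i := mul_le_mul_of_nonneg_right (hD.2 b) i.cast_nonneg
    have h2 : D * i ≤ D * (n + 1) := mul_le_mul_of_nonneg_left hi' hD.1.le
    linarith [hC b]

theorem isOverconvergent_zero (hν : IsPseudovaluation ν) :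
    IsOverconvergent p ν (0 : WittVector p A) :=
  (isOverconvergent_iff _).mpr ⟨1, one_pos, 0, fun i => by
    rw [WittVector.zero_coeff, hν.map_zero]; exact le_top⟩

theorem isOverconvergent_one (hν : IsPseudovaluation ν) :
    IsOverconvergent p ν (1 : WittVector p A) :=
  (isOverconvergent_iff _).mpr ⟨1, one_pos, 0, fun i => by
    rcases Nat.eq_zero_or_pos i with rfl | hi
    · simp [hν.map_one]
    · rw [WittVector.one_coeff_eq_of_pos _ _ _ hi, hν.map_zero]; exact le_top⟩

theorem isOverconvergent_add (hν : IsPseudovaluation ν) {x y : WittVector p A}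
    (hx : IsOverconvergent p ν x) (hy : IsOverconvergent p ν y) :
    IsOverconvergent p ν (x + y) := by
  refine isOverconvergent_peval hν (WittVector.wittAdd p) 1 hp.out.one_lt.le
    (wittStructureInt_homogeneous _ _ fun n => ?_) ![x, y] ?_ (x + y) fun n => ?_
  · simp only [map_add, MvPolynomial.map_X, MvPolynomial.bind₁_X_right, one_mul]
    exact (wittPolynomial_homogeneous _ n).add (wittPolynomial_homogeneous _ n)
  · intro b; fin_cases b
    · exact hx
    · exact hy
  · rw [WittVector.add_coeff]; congr 1; funext b; fin_cases b <;> rfl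

theorem isOverconvergent_mul (hν : IsPseudovaluation ν) {x y : WittVector p A}
    (hx : IsOverconvergent p ν x) (hy : IsOverconvergent p ν y) :
    IsOverconvergent p ν (x * y) := by
  refine isOverconvergent_peval hν (WittVector.wittMul p) 2 hp.out.two_le
    (wittStructureInt_homogeneous _ _ fun n => ?_) ![x, y] ?_ (x * y) fun n => ?_
  · simp only [map_mul, MvPolynomial.map_X, MvPolynomial.bind₁_X_right, two_mul]
    exact (wittPolynomial_homogeneous _ n).mul (wittPolynomial_homogeneous _ n)
  · intro b; fin_cases b
    · exact hx
    · exact hy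
  · rw [WittVector.mul_coeff]; congr 1; funext b; fin_cases b <;> rfl

theorem isOverconvergent_neg (hν : IsPseudovaluation ν) {x : WittVector p A}
    (hx : IsOverconvergent p ν x) : IsOverconvergent p ν (-x) := by
  refine isOverconvergent_peval hν (WittVector.wittNeg p) 1 hp.out.one_lt.le
    (wittStructureInt_homogeneous _ _ fun n => ?_) ![x] ?_ (-x) fun n => ?_
  · simp only [map_neg, MvPolynomial.map_X, MvPolynomial.bind₁_X_right, one_mul]
    exact (wittPolynomial_homogeneous _ n).neg
  · intro b; fin_cases b; exact hx
  · rw [WittVector.neg_coeff]; congr 1; funext b; fin_cases b; rfl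

end Aux

/-- The ring `W†(A)` of overconvergent Witt vectors, with respect to a pseudovaluation `ν`. -/
def overconvergentWitt (p : ℕ) [Fact p.Prime] {A : Type*} [CommRing A] {ν : A → EReal}
    (hν : IsPseudovaluation ν) : Subring (WittVector p A) where
  carrier := {α | IsOverconvergent p ν α}
  zero_mem' := isOverconvergent_zero hν
  one_mem' := isOverconvergent_one hν
  add_mem' := isOverconvergent_add hν
  mul_mem' := isOverconvergent_mul hν
  neg_mem' := isOverconvergent_neg hν

/-- The homomorphism `w₀ : W†(A) → A`, `(a₀, a₁, …) ↦ a₀`. -/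
noncomputable def w₀ (p : ℕ) [Fact p.Prime] {A : Type*} [CommRing A] {ν : A → EReal}
    (hν : IsPseudovaluation ν) : overconvergentWitt p hν →+* A :=
  WittVector.constantCoeff.comp (overconvergentWitt p hν).subtype

end OverconvergentWitt

/-! The root is `x + [a]`, where `x` is a fixed point of `g(X) = X - [u⁻¹] f(X + [a])` with `u =
f'(a)`. By the hypotheses on `a`, both `g(0)` and `g'(0)` have zeroth coefficient `0`. In
characteristic `p` one has `VⁿW · VW ⊆ Vⁿ⁺¹W`, so `g` contracts `VW(A)` and its iterates from `0`
stabilise coefficientwise to a fixed point (`exists_eval_eq_self`).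

V-adic convergence alone does not give overconvergence. For that, put `γ_δ(x) = inf_i (i + p⁻ⁱ ν(xᵢ)
/ δ)` for `δ > 0`. In characteristic `p`, `γ_δ(xy) ≥ γ_δ(x) + γ_δ(y)` (`GaussBound.mul`). For
overconvergent `x` and large `δ`, `γ_δ(x)` exceeds any given negative number, and any given number
below `1` if `x₀ = 0`. So one `δ` gives `γ_δ ≥ -1/2` on all coefficients of `g` and `γ_δ ≥ 1/2` on
the constant and linear ones. Then `g` preserves `γ_δ ≥ 1/2` (`GaussBound.eval`), and the limit
inherits this bound, coefficient by coefficient.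

Uniqueness already holds in `W(A)`: by Taylor expansion the difference of two such roots is killed
by an element with unit zeroth coefficient, which is not a zero divisor. -/

namespace OverconvergentWitt

open WittVector Filter

/-! ### Gauss norms on Witt vectors -/

section GaussBound

variable {p : ℕ} {A : Type*} {ν : A → EReal}

/-- The first `n` coefficients of `x` satisfy `ν (x i) ≥ p ^ i * δ * (r - i)`, that is, up to
index `n` the Gauss norm of `x` of radius `1 / δ` is at least `r`. -/
def GaussBound (ν : A → EReal) (δ r : ℝ) (n : ℕ) (x : WittVector p A) : Prop :=
  ∀ i < n, (((p : ℝ) ^ i * (δ * (r - i)) : ℝ) : EReal) ≤ ν (x.coeff i)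

theorem GaussBound.mono {δ r s : ℝ} {m n : ℕ} {x : WittVector p A} (h : GaussBound ν δ r n x)
    (hδ : 0 ≤ δ) (hs : s ≤ r) (hm : m ≤ n) : GaussBound ν δ s m x := fun i hi =>
  (EReal.coe_le_coe_iff.mpr (by gcongr)).trans (h i (hi.trans_le hm))

theorem GaussBound.shift {δ r : ℝ} {n : ℕ} {x : WittVector p A}
    (h : GaussBound ν δ r (n + 1) x) : GaussBound ν (p * δ) (r - 1) n (x.shift 1) := by
  intro i hi
  rw [shift_coeff, add_comm 1 i]
  convert h (i + 1) (Nat.succ_lt_succ hi) using 2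
  push_cast; ring

variable [CommRing A] [hp : Fact p.Prime]

/-- The `m`-th addition polynomial is homogeneous of weight `pᵐ` when the `i`-th variables have
weight `pⁱ`, and it only involves `i ≤ m`, where `r - m ≤ r - i`. -/
theorem GaussBound.add (hν : IsPseudovaluation ν) {δ r : ℝ} (hδ : 0 ≤ δ) {n : ℕ}
    {x y : WittVector p A} (hx : GaussBound ν δ r n x) (hy : GaussBound ν δ r n y) :
    GaussBound ν δ r n (x + y) := by
  intro m hm
  have hw : (wittAdd p m).IsWeightedHomogeneous (fun s : Fin 2 × ℕ => p ^ s.2) (1 * p ^ m) := by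
    refine wittStructureInt_homogeneous _ _ (fun n => ?_) m
    simp only [map_add, MvPolynomial.map_X, MvPolynomial.bind₁_X_right, one_mul]
    exact (wittPolynomial_homogeneous _ n).add (wittPolynomial_homogeneous _ n)
  rw [one_mul] at hw
  have hb := aeval_bound hν hw (x := Function.uncurry ![x.coeff, y.coeff]) (t := δ * (r - m)) ?_
  · rw [WittVector.add_coeff]
    simpa [peval] using hb
  · rintro ⟨b, i⟩ hs
    have hi : i ≤ m := (Nat.pow_le_pow_iff_right hp.out.one_lt).mp hs
    have hle : (((p ^ i : ℕ) : ℝ) * (δ * (r - m)) : ℝ) ≤ (p : ℝ) ^ i * (δ * (r - i)) := by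
      push_cast
      gcongr
    refine (EReal.coe_le_coe_iff.mpr hle).trans ?_
    fin_cases b
    · exact hx i (hi.trans_lt hm)
    · exact hy i (hi.trans_lt hm)

theorem GaussBound.zero (hν : IsPseudovaluation ν) (δ r : ℝ) (n : ℕ) :
    GaussBound ν δ r n (0 : WittVector p A) := fun i _ => by
  rw [WittVector.zero_coeff, hν.map_zero]; exact le_top

theorem GaussBound.sum (hν : IsPseudovaluation ν) {δ r : ℝ} (hδ : 0 ≤ δ) {n : ℕ} {ι : Type*}
    (s : Finset ι) (x : ι → WittVector p A) (h : ∀ i ∈ s, GaussBound ν δ r n (x i)) :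
    GaussBound ν δ r n (∑ i ∈ s, x i) :=
  Finset.sum_induction _ _ (fun _ _ => GaussBound.add hν hδ) (GaussBound.zero hν _ _ _) h

theorem gaussBound_teichmuller (hν : IsPseudovaluation ν) {δ r : ℝ} {a : A}
    (ha : ((δ * r : ℝ) : EReal) ≤ ν a) (n : ℕ) : GaussBound ν δ r n (teichmuller p a) := by
  intro i _
  rcases Nat.eq_zero_or_pos i with rfl | hi
  · simpa using ha
  · rw [teichmuller_coeff_pos p a i hi, hν.map_zero]; exact le_top

theorem GaussBound.verschiebung (hν : IsPseudovaluation ν) {δ r : ℝ} {n : ℕ}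
    {x : WittVector p A} (h : GaussBound ν (p * δ) (r - 1) n x) :
    GaussBound ν δ r (n + 1) (WittVector.verschiebung x) := by
  rintro (_ | i) hi
  · rw [verschiebung_coeff_zero, hν.map_zero]; exact le_top
  · rw [verschiebung_coeff_succ]
    convert h i (Nat.lt_of_succ_lt_succ hi) using 2
    push_cast; ring

theorem GaussBound.frobenius [CharP A p] (hν : IsPseudovaluation ν) {δ r : ℝ} {n : ℕ}
    {x : WittVector p A} (h : GaussBound ν δ r n x) :
    GaussBound ν (p * δ) r n (WittVector.frobenius x) := by
  intro i hi
  rw [coeff_frobenius_charP]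
  convert pow_bound hν (h i hi) p using 2
  ring

theorem teichmuller_add_verschiebung_shift (x : WittVector p A) :
    teichmuller p (x.coeff 0) + verschiebung (x.shift 1) = x := by
  ext n
  rw [coeff_add_of_disjoint]
  · cases n with
    | zero => simp
    | succ n => simp [shift_coeff, add_comm 1 n, teichmuller_coeff_pos]
  · intro n
    cases n with
    | zero => right; simp
    | succ n => left; simp [teichmuller_coeff_pos]

/-- Induction on the length. Splitting off Teichmüller parts leaves products under one `V`. Both
shifting and Frobenius replace `δ` by `p * δ`, so the factors there match, and `V` undoes this
change of radius. -/
theorem GaussBound.mul [CharP A p] (hν : IsPseudovaluation ν) {δ r s : ℝ} (hδ : 0 ≤ δ) {n : ℕ}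
    {x y : WittVector p A} (hx : GaussBound ν δ r n x) (hy : GaussBound ν δ s n y) :
    GaussBound ν δ (r + s) n (x * y) := by
  induction n generalizing δ r s x y with
  | zero => intro i hi; exact absurd hi (Nat.not_lt_zero i)
  | succ n ih =>
    have hx0 : ((δ * r : ℝ) : EReal) ≤ ν (x.coeff 0) := by simpa using hx 0 n.succ_pos
    have hy0 : ((δ * s : ℝ) : EReal) ≤ ν (y.coeff 0) := by simpa using hy 0 n.succ_pos
    have hpδ : 0 ≤ p * δ := by positivity
    -- This is `xy = x[y₀] + x V(y')` with `x = [x₀] + V(x')`, rewritten by `V(z) w = V(z F(w))`.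
    have key : x * y = teichmuller p (x.coeff 0 * y.coeff 0) +
        WittVector.verschiebung
          (x.shift 1 * WittVector.frobenius (teichmuller p (y.coeff 0))) +
        WittVector.verschiebung (y.shift 1 * WittVector.frobenius x) := by
      rw [verschiebung_mul_frobenius, verschiebung_mul_frobenius, map_mul, ← add_mul,
        teichmuller_add_verschiebung_shift, mul_comm (WittVector.verschiebung _) x, ← mul_add,
        teichmuller_add_verschiebung_shift]
    rw [key]
    refine ((gaussBound_teichmuller hν ?_ _).add hν hδ (GaussBound.verschiebung hν ?_)).add hν hδ
      (GaussBound.verschiebung hν ?_)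
    · convert mul_bound hν hx0 hy0 using 2
      ring
    · convert ih hpδ hx.shift ((gaussBound_teichmuller hν hy0 n).frobenius hν) using 1
      ring
    · convert ih hpδ hy.shift ((hx.mono hδ le_rfl n.le_succ).frobenius hν) using 1
      ring

theorem GaussBound.pow_succ [CharP A p] (hν : IsPseudovaluation ν) {δ r : ℝ} (hδ : 0 ≤ δ)
    {n : ℕ} {x : WittVector p A} (hx : GaussBound ν δ r n x) (k : ℕ) :
    GaussBound ν δ ((k + 1) * r) n (x ^ (k + 1)) := by
  induction k with
  | zero => simpa using hx
  | succ k ih =>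
    rw [_root_.pow_succ]
    convert ih.mul hν hδ hx using 1
    push_cast; ring

/-- Shrinking the radius `1 / δ` scales the contribution of `ν` towards `0`, so any loss `r < 0` is
eventually enough. -/
theorem IsOverconvergent.eventually_gaussBound {x : WittVector p A} (hx : IsOverconvergent p ν x)
    {r : ℝ} (hr : r < 0) : ∀ᶠ δ in atTop, ∀ n, GaussBound ν δ r n x := by
  obtain ⟨δ₀, hδ₀, c, hc⟩ := (isOverconvergent_iff x).mp hx
  filter_upwards [eventually_ge_atTop δ₀, eventually_ge_atTop (c / r)] with δ h1 h2 n i _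
  refine (EReal.coe_le_coe_iff.mpr ?_).trans (hc i)
  rw [div_le_iff_of_neg hr] at h2
  have : δ₀ * i ≤ δ * i := by gcongr
  gcongr
  linarith

/-- With no term at `i = 0`, the summand `i ≥ 1` dominates for small radius, hence any `r < 1`. -/
theorem IsOverconvergent.eventually_gaussBound_of_coeff_zero (hν : IsPseudovaluation ν)
    {x : WittVector p A} (hx : IsOverconvergent p ν x) (h0 : x.coeff 0 = 0)
    {r : ℝ} (hr : r < 1) : ∀ᶠ δ in atTop, ∀ n, GaussBound ν δ r n x := by
  obtain ⟨δ₀, hδ₀, c, hc⟩ := (isOverconvergent_iff x).mp hx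
  filter_upwards [eventually_ge_atTop δ₀, eventually_ge_atTop ((δ₀ - c) / (1 - r))]
    with δ h1 h2 n i _
  rcases Nat.eq_zero_or_pos i with rfl | hi
  · rw [h0, hν.map_zero]; exact le_top
  refine (EReal.coe_le_coe_iff.mpr ?_).trans (hc i)
  rw [div_le_iff₀ (by linarith)] at h2
  have hi' : (1 : ℝ) ≤ i := by exact_mod_cast hi
  -- Reduces all `i ≥ 1` to `i = 1`, where the required inequality is the second threshold on `δ`.
  have : 0 ≤ (δ - δ₀) * (i - 1) := mul_nonneg (by linarith) (by linarith)
  gcongr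
  linarith

theorem GaussBound.isOverconvergent {δ r : ℝ} (hδ : 0 < δ) {x : WittVector p A}
    (hx : ∀ n, GaussBound ν δ r n x) : IsOverconvergent p ν x :=
  (isOverconvergent_iff x).mpr ⟨δ, hδ, δ * r, fun i => by
    convert hx (i + 1) i i.lt_succ_self using 2
    ring⟩

theorem isOverconvergent_teichmuller (hν : IsNegativePseudovaluation ν) (a : A) :
    IsOverconvergent p ν (teichmuller p a) := by
  obtain ⟨c, hc⟩ : ∃ c : ℝ, (c : EReal) ≤ ν a := by
    have h := hν.ne_bot a
    induction hx : ν a using EReal.rec with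
    | bot => exact absurd hx h
    | top => exact ⟨0, le_top⟩
    | coe x => exact ⟨x, le_rfl⟩
  exact GaussBound.isOverconvergent (r := c) one_pos
    (gaussBound_teichmuller hν.toIsPseudovaluation (by simpa using hc))

theorem IsOverconvergent.exists_verschiebung_eq {x : WittVector p A}
    (hx : IsOverconvergent p ν x) (h0 : x.coeff 0 = 0) :
    ∃ y : WittVector p A, IsOverconvergent p ν y ∧ x = verschiebung y := by
  refine ⟨x.shift 1, ?_, eq_iterate_verschiebung (n := 1) (by simpa using h0)⟩
  obtain ⟨δ, hδ, c, hc⟩ := (isOverconvergent_iff x).mp hx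
  have hp0 : (0 : ℝ) < p := by exact_mod_cast hp.out.pos
  refine (isOverconvergent_iff _).mpr ⟨p * δ, by positivity, p * (c - δ), fun i => ?_⟩
  rw [shift_coeff, add_comm 1 i]
  convert hc (i + 1) using 2
  push_cast; ring

end GaussBound

/-! ### V-adic contraction and fixed points in characteristic `p` -/

section Truncation

variable {p : ℕ} [hp : Fact p.Prime] {A : Type*} [CommRing A]

theorem sub_mem_ker_truncate_iff {n : ℕ} {x y : WittVector p A} :
    x - y ∈ RingHom.ker (truncate (p := p) (R := A) n) ↔ ∀ i < n, x.coeff i = y.coeff i := by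
  rw [RingHom.sub_mem_ker_iff]
  simp only [TruncatedWittVector.ext_iff, coeff_truncate]
  exact Fin.forall_iff

theorem mem_ker_truncate_one {x : WittVector p A} :
    x ∈ RingHom.ker (truncate (p := p) (R := A) 1) ↔ x.coeff 0 = 0 := by
  rw [mem_ker_truncate]
  simp

variable [CharP A p]

theorem mul_mem_ker_truncate_succ {n : ℕ} {x y : WittVector p A}
    (hx : x ∈ RingHom.ker (truncate (p := p) (R := A) n))
    (hy : y ∈ RingHom.ker (truncate (p := p) (R := A) 1)) :
    x * y ∈ RingHom.ker (truncate (p := p) (R := A) (n + 1)) := by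
  rw [mem_ker_truncate] at hx hy ⊢
  intro i hi
  rw [eq_iterate_verschiebung hx, eq_iterate_verschiebung hy, iterate_verschiebung_mul]
  exact iterate_verschiebung_coeff_eq_zero _ hi

/-- If `dᵢ = 0` for `i < n`, the `n`-th coefficient of `u * d` is `u₀ ^ (p ^ n) * dₙ`. -/
theorem eq_zero_of_mul_eq_zero_of_isUnit_coeff_zero {u d : WittVector p A}
    (hu : IsUnit (u.coeff 0)) (h : u * d = 0) : d = 0 := by
  ext n
  induction n using Nat.strong_induction_on with
  | _ n ih =>
    have hd := eq_iterate_verschiebung (p := p) (x := d) (n := n) fun i hi =>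
      (ih i hi).trans (WittVector.zero_coeff p A i)
    have hc := iterate_verschiebung_mul_coeff u (d.shift n) 0 n
    rw [← hd, Function.iterate_zero, id_eq, h, zero_add, WittVector.zero_coeff, shift_coeff,
      pow_zero, pow_one, add_zero] at hc
    rw [WittVector.zero_coeff]
    exact ((hu.pow _).mul_right_eq_zero).mp hc.symm

open Polynomial

/-- Contraction: `x - y` gets multiplied by an element of `VW(A)`, because the linear coefficient of
`g` and the points `x`, `y` lie there. -/
theorem eval_sub_eval_mem_ker_truncate_succ {g : (WittVector p A)[X]}
    (h1 : (g.coeff 1).coeff 0 = 0) {n : ℕ} {x y : WittVector p A}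
    (hx : x.coeff 0 = 0) (hy : y.coeff 0 = 0)
    (hxy : x - y ∈ RingHom.ker (truncate (p := p) (R := A) n)) :
    g.eval x - g.eval y ∈ RingHom.ker (truncate (p := p) (R := A) (n + 1)) := by
  obtain ⟨k, hk⟩ := sub_dvd_eval_sub x y g.divX
  have e : g.eval x - g.eval y = (x - y) * g.divX.eval x + (x - y) * k * y := by
    rw [← hk]
    conv_lhs => rw [← divX_mul_X_add g]
    simp only [eval_add, eval_mul, eval_X, eval_C]
    ring
  rw [e]
  refine Ideal.add_mem _ (mul_mem_ker_truncate_succ hxy ?_)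
    (mul_mem_ker_truncate_succ (Ideal.mul_mem_right _ _ hxy) (mem_ker_truncate_one.mpr hy))
  rw [mem_ker_truncate_one, ← divX_mul_X_add g.divX]
  simp [WittVector.add_coeff_zero, WittVector.mul_coeff_zero, hx, coeff_divX, h1]

/-- The last clause, agreement with an iterate up to any index, lets coefficientwise bounds pass to
the limit. -/
theorem exists_eval_eq_self (g : (WittVector p A)[X]) (h0 : (g.coeff 0).coeff 0 = 0)
    (h1 : (g.coeff 1).coeff 0 = 0) :
    ∃ x : WittVector p A, x.coeff 0 = 0 ∧ g.eval x = x ∧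
      ∀ n, ∃ k, ∀ i < n, x.coeff i = ((fun z => g.eval z)^[k] 0).coeff i := by
  set s : ℕ → WittVector p A := fun k => (fun z => g.eval z)^[k] 0 with hs
  have hsucc : ∀ k, s (k + 1) = g.eval (s k) := fun k => Function.iterate_succ_apply' _ _ _
  have heval : ∀ x : WittVector p A, x.coeff 0 = 0 → (g.eval x).coeff 0 = 0 := by
    intro x hx
    rw [← divX_mul_X_add g]
    simp [WittVector.add_coeff_zero, WittVector.mul_coeff_zero, hx, h0]
  have hs0 : ∀ k, (s k).coeff 0 = 0 := by
    intro k
    induction k with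
    | zero => simp [hs]
    | succ k ih => rw [hsucc]; exact heval _ ih
  have hstep : ∀ k, s (k + 1) - s k ∈ RingHom.ker (truncate (p := p) (R := A) k) := by
    intro k
    induction k with
    | zero => rw [sub_mem_ker_truncate_iff]; intro i hi; exact absurd hi (Nat.not_lt_zero i)
    | succ k ih =>
      rw [hsucc (k + 1), hsucc k]
      rw [hsucc k] at ih
      exact eval_sub_eval_mem_ker_truncate_succ h1 (heval _ (hs0 k)) (hs0 k) ih
  have hstab : ∀ i m, (s (i + 1 + m)).coeff i = (s (i + 1)).coeff i := by
    intro i m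
    induction m with
    | zero => rfl
    | succ m ih =>
      rw [← ih]
      exact sub_mem_ker_truncate_iff.mp (hstep (i + 1 + m)) i (by omega)
  let x : WittVector p A := WittVector.mk p fun i => (s (i + 1)).coeff i
  have hx : ∀ n, ∀ i < n, x.coeff i = (s n).coeff i := by
    intro n i hi
    obtain ⟨m, rfl⟩ := Nat.exists_eq_add_of_le (Nat.succ_le_of_lt hi)
    exact (hstab i m).symm
  have hx0 : x.coeff 0 = 0 := hs0 1
  refine ⟨x, hx0, ?_, fun n => ⟨n, hx n⟩⟩
  ext n
  have hxn := sub_mem_ker_truncate_iff.mpr (hx n)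
  have e1 := sub_mem_ker_truncate_iff.mp
    (eval_sub_eval_mem_ker_truncate_succ h1 hx0 (hs0 n) hxn) n n.lt_succ_self
  rw [e1, ← hsucc, hx (n + 1) n n.lt_succ_self]

end Truncation

/-! ### Overconvergence of the fixed point and Hensel's lemma -/

section Hensel

open Polynomial

variable {p : ℕ} [hp : Fact p.Prime] {A : Type*} [CommRing A] [CharP A p] {ν : A → EReal}

/-- The term of degree `j ≥ 2` has bound `-1/2 + j/2 ≥ 1/2`; lower degrees use the stronger bounds
on their coefficients. -/
theorem GaussBound.eval (hν : IsPseudovaluation ν) {δ : ℝ} (hδ : 0 ≤ δ) {n : ℕ}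
    {g : (WittVector p A)[X]} (h0 : GaussBound ν δ (1 / 2) n (g.coeff 0))
    (h1 : GaussBound ν δ (1 / 2) n (g.coeff 1))
    (hg : ∀ j ∈ g.support, GaussBound ν δ (-(1 / 2)) n (g.coeff j)) {x : WittVector p A}
    (hx : GaussBound ν δ (1 / 2) n x) : GaussBound ν δ (1 / 2) n (g.eval x) := by
  rw [eval_eq_sum, Polynomial.sum]
  refine GaussBound.sum hν hδ _ _ fun j hj => ?_
  rcases j with _ | _ | j
  · simpa using h0
  · simpa using (h1.mul hν hδ hx).mono hδ (by norm_num) le_rfl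
  · refine ((hg _ hj).mul hν hδ (hx.pow_succ hν hδ (j + 1))).mono hδ ?_ le_rfl
    have : (0 : ℝ) ≤ j := j.cast_nonneg
    push_cast
    linarith

theorem exists_isOverconvergent_eval_eq_self (hν : IsPseudovaluation ν) (g : (WittVector p A)[X])
    (hg : ∀ j, IsOverconvergent p ν (g.coeff j)) (h0 : (g.coeff 0).coeff 0 = 0)
    (h1 : (g.coeff 1).coeff 0 = 0) :
    ∃ x : WittVector p A, IsOverconvergent p ν x ∧ x.coeff 0 = 0 ∧ g.eval x = x := by
  obtain ⟨x, hx0, hx, hlim⟩ := exists_eval_eq_self g h0 h1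
  refine ⟨x, ?_, hx0, hx⟩
  have hev : ∀ᶠ δ in atTop, ∀ j ∈ g.support, ∀ n, GaussBound ν δ (-(1 / 2)) n (g.coeff j) :=
    (Finset.eventually_all _).mpr fun j _ => (hg j).eventually_gaussBound (by norm_num)
  obtain ⟨δ, hδ, hδg, hδ0, hδ1⟩ := ((eventually_gt_atTop (0 : ℝ)).and (hev.and
    (((hg 0).eventually_gaussBound_of_coeff_zero hν h0 one_half_lt_one).and
      ((hg 1).eventually_gaussBound_of_coeff_zero hν h1 one_half_lt_one)))).exists
  refine GaussBound.isOverconvergent (r := 1 / 2) hδ fun n i hi => ?_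
  obtain ⟨k, hk⟩ := hlim n
  rw [hk i hi]
  suffices ∀ k, GaussBound ν δ (1 / 2) n ((fun z => g.eval z)^[k] 0) from this k i hi
  intro k
  induction k with
  | zero => exact GaussBound.zero hν _ _ _
  | succ k ih =>
    rw [Function.iterate_succ_apply']
    exact GaussBound.eval hν hδ.le (hδ0 n) (hδ1 n) (fun j hj => hδg j hj n) ih

/-- Taylor expansion at `x` gives `(F'(x) + k (y - x)) (y - x) = 0`, and the first factor has the
same zeroth coefficient as `F'(x)`. -/
theorem eq_of_eval_eq_zero {F : (WittVector p A)[X]} {x y : WittVector p A}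
    (hx : F.eval x = 0) (hy : F.eval y = 0) (hxy : x.coeff 0 = y.coeff 0)
    (hu : IsUnit ((F.derivative.eval x).coeff 0)) : y = x := by
  obtain ⟨k, hk⟩ := F.binomExpansion x (y - x)
  rw [add_sub_cancel, hx, hy] at hk
  have h0 : (y - x).coeff 0 = 0 :=
    mem_ker_truncate_one.mp (sub_mem_ker_truncate_iff.mpr (by simpa using hxy.symm))
  refine sub_eq_zero.mp (eq_zero_of_mul_eq_zero_of_isUnit_coeff_zero
    (u := F.derivative.eval x + k * (y - x)) ?_ ?_)
  · simpa [WittVector.add_coeff_zero, WittVector.mul_coeff_zero, h0] using hu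
  · rw [zero_add] at hk
    rw [hk]; ring

/-- Hensel's lemma for the overconvergent Witt vectors of a ring of characteristic `p`. -/
theorem existsUnique_eval_eq_zero (hν : IsNegativePseudovaluation ν)
    (f : (overconvergentWitt p hν.toIsPseudovaluation)[X]) (a : A)
    (hfa : (f.map (w₀ p hν.toIsPseudovaluation)).eval a = 0)
    (hf'a : IsUnit ((derivative (f.map (w₀ p hν.toIsPseudovaluation))).eval a)) :
    ∃! α : overconvergentWitt p hν.toIsPseudovaluation,
      f.eval α = 0 ∧
      ∃ η : overconvergentWitt p hν.toIsPseudovaluation,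
        (α : WittVector p A) - WittVector.teichmuller p a =
          WittVector.verschiebung (η : WittVector p A) := by
  let S := overconvergentWitt p hν.toIsPseudovaluation
  let w := w₀ p hν.toIsPseudovaluation
  have hw : ∀ x : S, w x = (x : WittVector p A).coeff 0 := fun _ => rfl
  have hmod : ∀ α : S, (∃ η : S, (α : WittVector p A) - teichmuller p a = verschiebung ↑η) ↔
      (α : WittVector p A).coeff 0 = a := by
    intro α
    have h : ((α : WittVector p A) - teichmuller p a).coeff 0 = 0 ↔
        (α : WittVector p A).coeff 0 = a := by
      rw [← mem_ker_truncate_one, sub_mem_ker_truncate_iff]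
      simp
    rw [← h]
    constructor
    · rintro ⟨η, hη⟩
      rw [hη, verschiebung_coeff_zero]
    · intro h0
      obtain ⟨y, hy, e⟩ := IsOverconvergent.exists_verschiebung_eq
        (S.sub_mem α.2 (isOverconvergent_teichmuller hν a)) h0
      exact ⟨⟨y, hy⟩, e⟩
  refine (existsUnique_congr fun α => and_congr_right' (hmod α)).mpr ?_
  obtain ⟨u, hu⟩ := hf'a
  let t : A → S := fun b => ⟨teichmuller p b, isOverconvergent_teichmuller hν b⟩
  have hwt : ∀ b, w (t b) = b := fun b => teichmuller_coeff_zero p b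
  have htu : t u * t ↑u⁻¹ = 1 := Subtype.ext <| by
    change teichmuller p (u : A) * teichmuller p (↑u⁻¹ : A) = 1
    rw [← map_mul, Units.mul_inv, map_one]
  -- Newton's map with the derivative frozen at `[a]` and its inverse replaced by the lift `[u⁻¹]`,
  -- recentred so that the root sought lies in `VW(A)`.
  let g : S[X] := X - C (t ↑u⁻¹) * f.comp (X + C (t a))
  have hg0 : w (g.coeff 0) = 0 := by
    have : g.coeff 0 = -(t ↑u⁻¹ * f.eval (t a)) := by
      rw [coeff_zero_eq_eval_zero]; simp [g]
    rw [this, map_neg, map_mul, ← eval_map_apply, hwt, hwt, hfa, mul_zero, neg_zero]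
  have hg1 : w (g.coeff 1) = 0 := by
    have : g.coeff 1 = 1 - t ↑u⁻¹ * (derivative f).eval (t a) := by
      have e : g.coeff 1 = (derivative g).eval 0 := by
        rw [← coeff_zero_eq_eval_zero, coeff_derivative]; simp
      rw [e]; simp [g, derivative_comp]
    rw [this, map_sub, map_one, map_mul, ← eval_map_apply, hwt, hwt, ← derivative_map, ← hu,
      Units.inv_mul, sub_self]
  obtain ⟨x, hx, hx0, hgx⟩ := exists_isOverconvergent_eval_eq_self hν.toIsPseudovaluation
    (g.map S.subtype) (fun j => by rw [coeff_map]; exact (g.coeff j).2)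
    (by rw [coeff_map]; exact hg0) (by rw [coeff_map]; exact hg1)
  lift x to S using hx
  replace hx0 : w x = 0 := hx0
  replace hgx : g.eval x = x := Subtype.ext ((eval_map_apply S.subtype x).symm.trans hgx)
  have hfx : f.eval (x + t a) = 0 := by
    have h : t ↑u⁻¹ * f.eval (x + t a) = 0 := by
      simpa [g] using hgx
    calc f.eval (x + t a) = t u * (t ↑u⁻¹ * f.eval (x + t a)) := by rw [← mul_assoc, htu, one_mul]
      _ = 0 := by rw [h, mul_zero]
  have hα : w (x + t a) = a := by rw [map_add, hx0, hwt, zero_add]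
  refine ⟨x + t a, ⟨hfx, hα⟩, ?_⟩
  rintro β ⟨hβ, hβ0⟩
  refine Subtype.ext (eq_of_eval_eq_zero (F := f.map S.subtype) ?_ ?_ ?_ ?_)
  · exact (eval_map_apply S.subtype _).trans (by rw [hfx, map_zero])
  · exact (eval_map_apply S.subtype _).trans (by rw [hβ, map_zero])
  · exact hα.trans hβ0.symm
  · have : (derivative (f.map S.subtype)).eval ↑(x + t a) =
        ((derivative f).eval (x + t a) : S) := by
      rw [derivative_map]; exact eval_map_apply S.subtype (x + t a)
    rw [this, ← hw, ← eval_map_apply, hα, ← derivative_map, ← hu]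
    exact u.isUnit

end Hensel

end OverconvergentWitt

open OverconvergentWitt Polynomial in
theorem mainTheorem3 (p : ℕ) [Fact p.Prime] {K A : Type*} [Field K] [CharP K p] [PerfectField K]
    [CommRing A] [Algebra K A] (μ : K → EReal) (hμ : IsNegativePseudovaluation μ)
    (ν : A → EReal) (hν : IsAdmissible μ ν)
    (f : (overconvergentWitt p hν.toIsPseudovaluation)[X]) (a : A)
    (hfa : (f.map (w₀ p hν.toIsPseudovaluation)).eval a = 0)
    (hf'a : IsUnit ((derivative (f.map (w₀ p hν.toIsPseudovaluation))).eval a)) :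
    ∃! α : overconvergentWitt p hν.toIsPseudovaluation,
      f.eval α = 0 ∧
      ∃ η : overconvergentWitt p hν.toIsPseudovaluation,
        (α : WittVector p A) - WittVector.teichmuller p a =
          WittVector.verschiebung (η : WittVector p A) := by
  -- `ν 1 = 0` and `ν 0 = ⊤` force `1 ≠ 0`, so `K` embeds in `A` and `A` has characteristic `p`.
  have : Nontrivial A := by
    refine ⟨0, 1, fun h => ?_⟩
    have h1 := hν.map_one
    rw [← h, hν.map_zero] at h1
    exact EReal.top_ne_zero h1
  have : CharP A p := charP_of_injective_algebraMap (algebraMap K A).injective p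
  exact existsUnique_eval_eq_zero hν.toIsNegativePseudovaluation f a hfa hf'a
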